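/- Let $G$ be an abelian group, and let $X, Y$ be independent, identically distributed $G$-valued discrete random variables (that is, they almost surely take values in a countable subset of $G$). For a discrete random variable $Z$ let $H(Z) = -\sum_{z} \mathbb{P}(Z=z)\log \mathbb{P}(Z=z) \in [0,\infty]$ denote its Shannon entropy (with $0\log 0=0$). If $H(X)<\infty$, then $H(X+Y)$ and $H(X-Y)$ are finite and $$\frac{3}{4}<\frac{H(X+Y)}{H(X-Y)}<\frac{4}{3},$$ where the quotient is read as $1$ when $H(X+Y)=H(X-Y)=0$. In particular, $H(X+Y)=0$ if and only if $H(X-Y)=0$. -/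

import Mathlib

open MeasureTheory ProbabilityTheory
open scoped ENNReal

/-- A random variable is discrete if it almost surely takes values in a countable set. -/
def IsDiscreteRV {Ω G : Type*} [MeasurableSpace Ω] (X : Ω → G) (μ : Measure Ω) : Prop :=
  ∃ S : Set G, S.Countable ∧ ∀ᵐ ω ∂μ, X ω ∈ S

/-- The Shannon entropy `H(X) = -∑ₓ P(X = x) log P(X = x)` (natural logarithm, `0 log 0 = 0`) of a
discrete random variable, as an element of `[0, ∞]`: the terms are nonnegative, so the sum always
makes sense, and it is `∞` exactly when the series diverges. -/
noncomputable def shannonEntropy {Ω G : Type*} [MeasurableSpace Ω] (X : Ω → G)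
    (μ : Measure Ω) : ℝ≥0∞ :=
  ∑' x : G, ENNReal.ofReal (Real.negMulLog (μ.real (X ⁻¹' {x})))

open Classical in
/-- The quotient `a / b` of real numbers with the convention `0 / 0 = 1`. -/
noncomputable def ratio (a b : ℝ) : ℝ :=
  if a = 0 ∧ b = 0 then 1 else a / b

/-! Write h = H(X), A = H(X+Y), B = H(X-Y). Two inequalities suffice. With X, Y, Z independent
copies, Kaimanovich–Vershik gives A + h ≤ H(X+Y-Z) + h ≤ 2B
(`massEntropy_massConv_massConv_add_le`), and the Ruzsa triangle inequality gives B + h ≤ 2A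
(`massEntropy_massConv_massNeg_add_le`). If h ≠ 0, then A, B < 2h strictly, since x + y = y + x and
x - x = y - y are coincidences between distinct pairs (`massEntropy_massConv_lt`). Inserting h > A/2
and h > B/2 yields 3A < 4B and 3B < 4A.

Both inequalities are instances of submodularity, derived from Gibbs' inequality for mass functions
valued in `ℝ≥0∞`, so that no summability has to be checked. -/

/-! ### Mass functions, surprisal and Gibbs' inequality. -/

/-- The information content `-log t` of an event of probability `t`. -/
noncomputable def surprisal (t : ℝ≥0∞) : ℝ≥0∞ := ENNReal.ofReal (-Real.log t.toReal)

/-- The Shannon entropy of a probability mass function. -/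
noncomputable def massEntropy {α : Type*} (p : α → ℝ≥0∞) : ℝ≥0∞ := ∑' a, p a * surprisal (p a)

/-- The additive convolution of two mass functions. -/
noncomputable def massConv {G : Type*} [AddCommGroup G] (p q : G → ℝ≥0∞) (c : G) : ℝ≥0∞ :=
  ∑' x, p x * q (c - x)

/-- The reflection of a mass function. -/
def massNeg {G : Type*} [AddCommGroup G] (p : G → ℝ≥0∞) (x : G) : ℝ≥0∞ := p (-x)

theorem surprisal_anti {s t : ℝ≥0∞} (hs : s ≠ 0) (ht : t ≠ ∞) (hst : s ≤ t) :
    surprisal t ≤ surprisal s := by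
  unfold surprisal
  have h0 : 0 < s.toReal := ENNReal.toReal_pos hs (ne_top_of_le_ne_top ht hst)
  exact ENNReal.ofReal_le_ofReal
    (neg_le_neg (Real.log_le_log h0 (ENNReal.toReal_mono ht hst)))

/-- Strictness needs `t ≤ 1`, as `ENNReal.ofReal` truncates to 0 beyond 1, and `s ≠ 0`, as `Real.log
0 = 0`. -/
theorem surprisal_strictAnti {s t : ℝ≥0∞} (hs : s ≠ 0) (hst : s < t) (ht : t ≤ 1) :
    surprisal t < surprisal s := by
  unfold surprisal
  have ht' : t ≠ ∞ := ne_top_of_le_ne_top ENNReal.one_ne_top ht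
  have hs' : s ≠ ∞ := ne_top_of_lt hst
  have h0 : 0 < s.toReal := ENNReal.toReal_pos hs hs'
  have h1 : s.toReal < t.toReal := (ENNReal.toReal_lt_toReal hs' ht').2 hst
  have h2 : t.toReal ≤ 1 := by simpa using ENNReal.toReal_mono ENNReal.one_ne_top ht
  refine (ENNReal.ofReal_lt_ofReal_iff ?_).2 (neg_lt_neg (Real.log_lt_log h0 h1))
  have := Real.log_neg h0 (h1.trans_le h2)
  linarith

theorem surprisal_mul_le {s t : ℝ≥0∞} (hs : s ≠ 0) (ht : t ≠ 0) (hs' : s ≠ ∞) (ht' : t ≠ ∞) :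
    surprisal (s * t) ≤ surprisal s + surprisal t := by
  unfold surprisal
  have h0 : 0 < s.toReal := ENNReal.toReal_pos hs hs'
  have h1 : 0 < t.toReal := ENNReal.toReal_pos ht ht'
  rw [ENNReal.toReal_mul, Real.log_mul h0.ne' h1.ne', neg_add]
  exact ENNReal.ofReal_add_le

theorem surprisal_one : surprisal 1 = 0 := by simp [surprisal]

theorem ofReal_negMulLog (t : ℝ≥0∞) (ht : t ≠ ∞) :
    ENNReal.ofReal (Real.negMulLog t.toReal) = t * surprisal t := by
  rw [surprisal, Real.negMulLog, neg_mul, ← mul_neg, ENNReal.ofReal_mul ENNReal.toReal_nonneg,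
    ENNReal.ofReal_toReal ht]

/-- The inequality `log t ≤ t - 1` at `t = c d / (a b)`, without subtraction. -/
theorem surprisal_add_one_le {a b c d : ℝ≥0∞} (ha : a ≠ 0) (hb : b ≠ 0) (hc : c ≠ 0) (hd : d ≠ 0)
    (ha' : a ≤ 1) (hb' : b ≤ 1) (hc' : c ≤ 1) (hd' : d ≤ 1) :
    surprisal a + surprisal b + 1 ≤ surprisal c + surprisal d + c * d / (a * b) := by
  lift a to NNReal using ne_top_of_le_ne_top ENNReal.one_ne_top ha'
  lift b to NNReal using ne_top_of_le_ne_top ENNReal.one_ne_top hb'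
  lift c to NNReal using ne_top_of_le_ne_top ENNReal.one_ne_top hc'
  lift d to NNReal using ne_top_of_le_ne_top ENNReal.one_ne_top hd'
  have pos : ∀ {x : NNReal}, (x : ℝ≥0∞) ≠ 0 → (0 : ℝ) < x := fun {x} hx => by
    have : x ≠ 0 := by simpa using hx
    exact_mod_cast pos_iff_ne_zero.2 this
  have nn : ∀ {x : NNReal}, (x : ℝ≥0∞) ≤ 1 → 0 ≤ -Real.log x := fun {x} hx => by
    have h : x ≤ 1 := by exact_mod_cast hx
    have := Real.log_nonpos x.2 (by exact_mod_cast h)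
    exact neg_nonneg.2 this
  have key := Real.log_le_sub_one_of_pos
    (div_pos (mul_pos (pos hc) (pos hd)) (mul_pos (pos ha) (pos hb)))
  rw [Real.log_div (mul_pos (pos hc) (pos hd)).ne' (mul_pos (pos ha) (pos hb)).ne',
    Real.log_mul (pos hc).ne' (pos hd).ne', Real.log_mul (pos ha).ne' (pos hb).ne'] at key
  have hq : (c : ℝ≥0∞) * d / (a * b) = ENNReal.ofReal ((c : ℝ) * d / (a * b)) := by
    rw [ENNReal.ofReal_div_of_pos (mul_pos (pos ha) (pos hb)),
      ENNReal.ofReal_mul c.coe_nonneg, ENNReal.ofReal_mul a.coe_nonneg]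
    simp
  unfold surprisal
  simp only [ENNReal.coe_toReal]
  rw [hq, ← ENNReal.ofReal_add (nn ha') (nn hb'), ← ENNReal.ofReal_one,
    ← ENNReal.ofReal_add (add_nonneg (nn ha') (nn hb')) zero_le_one,
    ← ENNReal.ofReal_add (nn hc') (nn hd'),
    ← ENNReal.ofReal_add (add_nonneg (nn hc') (nn hd')) (by positivity)]
  exact ENNReal.ofReal_le_ofReal (by linarith)

/-- Gibbs' inequality for the four-term comparisons that arise from submodularity. -/
theorem gibbs_inequality {α : Type*} {w u a b c d : α → ℝ≥0∞} (hw : ∑' i, w i = 1)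
    (hu : ∑' i, u i ≤ 1)
    (ha : ∀ i, w i ≠ 0 → a i ≠ 0) (hb : ∀ i, w i ≠ 0 → b i ≠ 0)
    (hc : ∀ i, w i ≠ 0 → c i ≠ 0) (hd : ∀ i, w i ≠ 0 → d i ≠ 0)
    (ha' : ∀ i, a i ≤ 1) (hb' : ∀ i, b i ≤ 1) (hc' : ∀ i, c i ≤ 1) (hd' : ∀ i, d i ≤ 1)
    (hwu : ∀ i, w i ≠ 0 → w i * (c i * d i / (a i * b i)) ≤ u i) :
    ∑' i, w i * (surprisal (a i) + surprisal (b i)) ≤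
      ∑' i, w i * (surprisal (c i) + surprisal (d i)) := by
  have key : ∀ i, w i * (surprisal (a i) + surprisal (b i)) + w i ≤
      w i * (surprisal (c i) + surprisal (d i)) + u i := fun i => by
    by_cases h : w i = 0
    · simp [h]
    calc _ = w i * (surprisal (a i) + surprisal (b i) + 1) := by ring
      _ ≤ w i * (surprisal (c i) + surprisal (d i) + c i * d i / (a i * b i)) := by
        refine mul_le_mul_right ?_ _
        exact surprisal_add_one_le (ha i h) (hb i h) (hc i h) (hd i h) (ha' i) (hb' i) (hc' i)
          (hd' i)
      _ ≤ _ := by rw [mul_add]; gcongr; exact hwu i h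
  have h := ENNReal.tsum_le_tsum key
  rw [ENNReal.tsum_add, ENNReal.tsum_add, hw] at h
  -- Only the finite total weight 1 is cancelled, so both sides may be infinite.
  exact (ENNReal.add_le_add_iff_right ENNReal.one_ne_top).1 (h.trans (by gcongr))

theorem le_one_of_tsum_eq_one {α : Type*} {p : α → ℝ≥0∞} (hp : ∑' x, p x = 1) (x : α) : p x ≤ 1 :=
  hp ▸ ENNReal.le_tsum x

theorem ne_top_of_tsum_eq_one {α : Type*} {p : α → ℝ≥0∞} (hp : ∑' x, p x = 1) (x : α) :
    p x ≠ ∞ :=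
  ne_top_of_le_ne_top ENNReal.one_ne_top (le_one_of_tsum_eq_one hp x)

theorem tsum_prod_mul_eq_one {G : Type*} {p q : G → ℝ≥0∞} (hp : ∑' x, p x = 1) (hq : ∑' x, q x = 1) :
    ∑' i : G × G, p i.1 * q i.2 = 1 := by
  rw [ENNReal.tsum_prod' (f := fun i : G × G => p i.1 * q i.2)]
  simp [ENNReal.tsum_mul_left, hp, hq]

theorem tsum_prod_mul_fst {G : Type*} {q : G → ℝ≥0∞} (hq : ∑' x, q x = 1) (p f : G → ℝ≥0∞) :
    ∑' i : G × G, p i.1 * q i.2 * f i.1 = ∑' x, p x * f x := by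
  rw [ENNReal.tsum_prod' (f := fun i : G × G => p i.1 * q i.2 * f i.1)]
  simp [ENNReal.tsum_mul_left, ENNReal.tsum_mul_right, hq]

theorem tsum_prod_mul_snd {G : Type*} {p : G → ℝ≥0∞} (hp : ∑' x, p x = 1) (q f : G → ℝ≥0∞) :
    ∑' i : G × G, p i.1 * q i.2 * f i.2 = ∑' x, q x * f x := by
  rw [ENNReal.tsum_prod' (f := fun i : G × G => p i.1 * q i.2 * f i.2)]
  simp [ENNReal.tsum_mul_left, ENNReal.tsum_mul_right, hp, mul_assoc]

theorem tsum_prod_mul_add {G : Type*} {p q : G → ℝ≥0∞} (hp : ∑' x, p x = 1) (hq : ∑' x, q x = 1) :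
    ∑' i : G × G, p i.1 * q i.2 * (surprisal (p i.1) + surprisal (q i.2)) =
      massEntropy p + massEntropy q := by
  simp only [mul_add]
  rw [ENNReal.tsum_add, tsum_prod_mul_fst hq p (fun x => surprisal (p x)),
    tsum_prod_mul_snd hp q (fun x => surprisal (q x))]
  rfl

theorem tsum_triple {G : Type*} (f : G × G × G → ℝ≥0∞) : ∑' i, f i = ∑' x, ∑' y, ∑' z, f (x, y, z) := by
  rw [ENNReal.tsum_prod']
  exact tsum_congr fun x => ENNReal.tsum_prod'

theorem mul_div_mul_cancel_weight {w m a n : ℝ≥0∞} (hm : m ≠ 0) (hm' : m ≠ ∞) :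
    w * m * (n / (a * m)) = w * (n / a) := by
  rw [mul_assoc, ← mul_div_assoc, mul_comm a m, ENNReal.mul_div_mul_left _ _ hm hm']

/-! ### Convolution and the entropy of sums. -/

section Convolution

variable {G : Type*} [AddCommGroup G]

theorem tsum_massConv_mul (p q f : G → ℝ≥0∞) :
    ∑' c, massConv p q c * f c = ∑' x, ∑' y, p x * q y * f (x + y) := by
  simp only [massConv, ← ENNReal.tsum_mul_right]
  rw [ENNReal.tsum_comm]
  refine tsum_congr fun x => ?_
  rw [← (Equiv.addLeft x).tsum_eq]
  simp

theorem tsum_massConv {p q : G → ℝ≥0∞} (hp : ∑' x, p x = 1) (hq : ∑' x, q x = 1) :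
    ∑' c, massConv p q c = 1 := by
  have := tsum_massConv_mul p q 1
  simpa [ENNReal.tsum_mul_left, hp, hq] using this

theorem tsum_massNeg_mul (p f : G → ℝ≥0∞) :
    ∑' x, massNeg p x * f x = ∑' x, p x * f (-x) := by
  rw [← (Equiv.neg G).tsum_eq]
  simp [massNeg]

theorem tsum_massNeg {p : G → ℝ≥0∞} (hp : ∑' x, p x = 1) : ∑' x, massNeg p x = 1 := by
  simpa [hp] using tsum_massNeg_mul p 1

theorem massEntropy_massNeg (p : G → ℝ≥0∞) : massEntropy (massNeg p) = massEntropy p := by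
  unfold massEntropy
  rw [tsum_massNeg_mul p (fun x => surprisal (massNeg p x))]
  simp [massNeg]

theorem massConv_comm (p q : G → ℝ≥0∞) : massConv p q = massConv q p := by
  funext c
  unfold massConv
  rw [← (Equiv.subLeft c).tsum_eq]
  simp [mul_comm]

theorem massConv_assoc (p q m : G → ℝ≥0∞) :
    massConv (massConv p q) m = massConv p (massConv q m) := by
  funext c
  rw [massConv, tsum_massConv_mul p q (fun u => m (c - u)), massConv]
  refine tsum_congr fun x => ?_
  rw [massConv, ← ENNReal.tsum_mul_left]
  exact tsum_congr fun y => by rw [mul_assoc, sub_sub]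

theorem mul_le_massConv (p q : G → ℝ≥0∞) (x y : G) : p x * q y ≤ massConv p q (x + y) := by
  simpa [massConv] using ENNReal.le_tsum (f := fun z => p z * q (x + y - z)) x

theorem massConv_ne_zero {p q : G → ℝ≥0∞} {x y : G} (hx : p x ≠ 0) (hy : q y ≠ 0) :
    massConv p q (x + y) ≠ 0 :=
  ((pos_iff_ne_zero.2 (mul_ne_zero hx hy)).trans_le (mul_le_massConv p q x y)).ne'

theorem massEntropy_massConv (p q : G → ℝ≥0∞) :
    massEntropy (massConv p q) =
      ∑' i : G × G, p i.1 * q i.2 * surprisal (massConv p q (i.1 + i.2)) := by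
  rw [massEntropy, tsum_massConv_mul p q (fun c => surprisal (massConv p q c)),
    ENNReal.tsum_prod' (f := fun i : G × G => p i.1 * q i.2 * surprisal (massConv p q (i.1 + i.2)))]

theorem surprisal_massConv_le {p q : G → ℝ≥0∞} (hp : ∑' x, p x = 1) (hq : ∑' x, q x = 1)
    (x y : G) : p x * q y * surprisal (massConv p q (x + y)) ≤
      p x * q y * (surprisal (p x) + surprisal (q y)) := by
  by_cases hx : p x = 0
  · simp [hx]
  by_cases hy : q y = 0
  · simp [hy]
  gcongr
  exact (surprisal_anti (mul_ne_zero hx hy) (ne_top_of_tsum_eq_one (tsum_massConv hp hq) _)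
    (mul_le_massConv p q x y)).trans
    (surprisal_mul_le hx hy (ne_top_of_tsum_eq_one hp x) (ne_top_of_tsum_eq_one hq y))

theorem massEntropy_massConv_le {p q : G → ℝ≥0∞} (hp : ∑' x, p x = 1) (hq : ∑' x, q x = 1) :
    massEntropy (massConv p q) ≤ massEntropy p + massEntropy q := by
  rw [massEntropy_massConv, ← tsum_prod_mul_add hp hq]
  exact ENNReal.tsum_le_tsum fun i => surprisal_massConv_le hp hq i.1 i.2

/-- If a sum of independent variables takes some value in two ways, its entropy is strictly
smaller than the sum of the entropies. -/
theorem massEntropy_massConv_lt {p q : G → ℝ≥0∞} (hp : ∑' x, p x = 1) (hq : ∑' x, q x = 1)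
    (hfp : massEntropy p ≠ ∞) (hfq : massEntropy q ≠ ∞) {x y x' y' : G} (hxx' : x ≠ x')
    (hxy : x + y = x' + y') (hx : p x ≠ 0) (hy : q y ≠ 0) (hx' : p x' ≠ 0) (hy' : q y' ≠ 0) :
    massEntropy (massConv p q) < massEntropy p + massEntropy q := by
  have hfin : massEntropy (massConv p q) ≠ ∞ :=
    ne_top_of_le_ne_top (ENNReal.add_ne_top.2 ⟨hfp, hfq⟩) (massEntropy_massConv_le hp hq)
  rw [massEntropy_massConv] at hfin ⊢
  rw [← tsum_prod_mul_add hp hq]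
  refine ENNReal.tsum_lt_tsum (i := (x, y)) hfin
    (fun i => surprisal_massConv_le hp hq i.1 i.2) ?_
  have hpt := ne_top_of_tsum_eq_one hp x
  have hqt := ne_top_of_tsum_eq_one hq y
  -- The second representation `x' + y'` contributes positive mass to the same value.
  have hlt : p x * q y < massConv p q (x + y) := by
    classical
    calc p x * q y < p x * q y + p x' * q y' :=
          ENNReal.lt_add_right (ENNReal.mul_ne_top hpt hqt) (mul_ne_zero hx' hy')
      _ = ∑ z ∈ {x, x'}, p z * q (x + y - z) := by
        rw [Finset.sum_pair hxx', add_sub_cancel_left]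
        rw [hxy, add_sub_cancel_left]
      _ ≤ _ := ENNReal.sum_le_tsum _
  refine (ENNReal.mul_lt_mul_iff_right (mul_ne_zero hx hy) (ENNReal.mul_ne_top hpt hqt)).2 ?_
  exact (surprisal_strictAnti (mul_ne_zero hx hy) hlt
    (le_one_of_tsum_eq_one (tsum_massConv hp hq) _)).trans_le (surprisal_mul_le hx hy hpt hqt)

/-- For each fixed y, the translate of `massConv p q` by y is a probability mass function; Gibbs
compares p with it, and the result is averaged over y. -/
theorem massEntropy_le_massConv {p q : G → ℝ≥0∞} (hp : ∑' x, p x = 1) (hq : ∑' x, q x = 1) :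
    massEntropy p ≤ massEntropy (massConv p q) := by
  have hu : ∑' i : G × G, q i.2 * massConv p q (i.1 + i.2) ≤ 1 := by
    rw [ENNReal.tsum_prod' (f := fun i : G × G => q i.2 * massConv p q (i.1 + i.2)),
      ENNReal.tsum_comm]
    simp only [ENNReal.tsum_mul_left]
    have : ∀ y, ∑' x, massConv p q (x + y) = 1 := fun y => by
      rw [← tsum_massConv hp hq, ← (Equiv.addRight y).tsum_eq (massConv p q)]; rfl
    simp [this, hq]
  have h := gibbs_inequality (w := fun i : G × G => p i.1 * q i.2) (a := fun i => p i.1)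
    (b := fun _ => 1) (c := fun i => massConv p q (i.1 + i.2)) (d := fun _ => 1)
    (tsum_prod_mul_eq_one hp hq) hu (fun i hi => left_ne_zero_of_mul hi) (by simp)
    (fun i hi => massConv_ne_zero (left_ne_zero_of_mul hi) (right_ne_zero_of_mul hi)) (by simp)
    (fun i => le_one_of_tsum_eq_one hp _) (by simp)
    (fun i => le_one_of_tsum_eq_one (tsum_massConv hp hq) _) (by simp)
    (fun i hi => by
      rw [mul_one, mul_one, mul_comm (p i.1), mul_assoc,
        ENNReal.mul_div_cancel (left_ne_zero_of_mul hi) (ne_top_of_tsum_eq_one hp _)])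
  simp only [surprisal_one, add_zero] at h
  rwa [tsum_prod_mul_fst hq p (fun x => surprisal (p x)), ← massEntropy_massConv] at h

/-! ### Submodularity inequalities. -/

/-- The common part of the two submodularity inequalities. The weight is `p x q y m z`. -/
theorem entropy_submodularity {p q m r : G → ℝ≥0∞} (hp : ∑' x, p x = 1) (hq : ∑' x, q x = 1)
    (hm : ∑' x, m x = 1) (hr : ∑' x, r x = 1) (φ : G → G → G → G)
    (hrφ : ∀ x y z, p x ≠ 0 → q y ≠ 0 → m z ≠ 0 → r (φ x y z) ≠ 0)
    (hent : massEntropy r = ∑' x, ∑' y, ∑' z, p x * q y * m z * surprisal (r (φ x y z)))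
    (hu : ∑' x, ∑' y, ∑' z, p x * q y *
      (massConv p m (x + z) * massConv q m (y + z) / r (φ x y z)) ≤ 1) :
    massEntropy r + massEntropy m ≤ massEntropy (massConv p m) + massEntropy (massConv q m) := by
  have hw : ∑' i : G × G × G, p i.1 * q i.2.1 * m i.2.2 = 1 := by
    rw [tsum_triple]
    simp [ENNReal.tsum_mul_left, hp, hq, hm]
  rw [← tsum_triple (fun i => p i.1 * q i.2.1 *
    (massConv p m (i.1 + i.2.2) * massConv q m (i.2.1 + i.2.2) / r (φ i.1 i.2.1 i.2.2)))] at hu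
  have h := gibbs_inequality (w := fun i : G × G × G => p i.1 * q i.2.1 * m i.2.2)
    (a := fun i => r (φ i.1 i.2.1 i.2.2)) (b := fun i => m i.2.2)
    (c := fun i => massConv p m (i.1 + i.2.2)) (d := fun i => massConv q m (i.2.1 + i.2.2))
    hw hu
    (fun i hi => hrφ _ _ _ (left_ne_zero_of_mul (left_ne_zero_of_mul hi))
      (right_ne_zero_of_mul (left_ne_zero_of_mul hi)) (right_ne_zero_of_mul hi))
    (fun i hi => right_ne_zero_of_mul hi)
    (fun i hi => massConv_ne_zero (left_ne_zero_of_mul (left_ne_zero_of_mul hi))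
      (right_ne_zero_of_mul hi))
    (fun i hi => massConv_ne_zero (right_ne_zero_of_mul (left_ne_zero_of_mul hi))
      (right_ne_zero_of_mul hi))
    (fun i => le_one_of_tsum_eq_one hr _) (fun i => le_one_of_tsum_eq_one hm _)
    (fun i => le_one_of_tsum_eq_one (tsum_massConv hp hm) _)
    (fun i => le_one_of_tsum_eq_one (tsum_massConv hq hm) _)
    (fun i hi => (mul_div_mul_cancel_weight (right_ne_zero_of_mul hi)
      (ne_top_of_tsum_eq_one hm _)).le)
  have hM : massEntropy m = ∑' x, ∑' y, ∑' z, p x * q y * m z * surprisal (m z) := by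
    simp only [mul_assoc, ENNReal.tsum_mul_left, ENNReal.tsum_mul_right, hp, hq, one_mul]
    rfl
  have hP : massEntropy (massConv p m) =
      ∑' x, ∑' y, ∑' z, p x * q y * m z * surprisal (massConv p m (x + z)) := by
    rw [massEntropy, tsum_massConv_mul p m (fun c => surprisal (massConv p m c))]
    refine tsum_congr fun x => ?_
    simp only [mul_assoc, ENNReal.tsum_mul_left, ENNReal.tsum_mul_right, hq, one_mul]
  have hQ : massEntropy (massConv q m) =
      ∑' x, ∑' y, ∑' z, p x * q y * m z * surprisal (massConv q m (y + z)) := by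
    rw [massEntropy, tsum_massConv_mul q m (fun c => surprisal (massConv q m c))]
    simp only [mul_assoc, ENNReal.tsum_mul_left, ENNReal.tsum_mul_right, hp, one_mul]
  simp only [mul_add] at h
  rw [ENNReal.tsum_add, ENNReal.tsum_add, tsum_triple, tsum_triple, tsum_triple, tsum_triple] at h
  rwa [hent, hM, hP, hQ]

/-- The Kaimanovich–Vershik inequality. -/
theorem massEntropy_massConv_massConv_add_le {p q m : G → ℝ≥0∞} (hp : ∑' x, p x = 1)
    (hq : ∑' x, q x = 1) (hm : ∑' x, m x = 1) :
    massEntropy (massConv p (massConv q m)) + massEntropy m ≤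
      massEntropy (massConv p m) + massEntropy (massConv q m) := by
  have hr := tsum_massConv hp (tsum_massConv hq hm)
  refine entropy_submodularity hp hq hm hr (fun x y z => x + (y + z))
    (fun x y z hx hy hz => massConv_ne_zero hx (massConv_ne_zero hy hz)) ?_ ?_
  · rw [massEntropy, tsum_massConv_mul p _
      (fun c => surprisal (massConv p (massConv q m) c))]
    refine tsum_congr fun x => ?_
    simp only [mul_assoc, ENNReal.tsum_mul_left]
    rw [tsum_massConv_mul q m (fun c => surprisal (massConv p (massConv q m) (x + c)))]
    simp only [mul_assoc, ENNReal.tsum_mul_left]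
  · set r := massConv p (massConv q m) with hrdef
    have hr2 : r = massConv q (massConv p m) := by
      rw [hrdef, ← massConv_assoc, massConv_comm p q, massConv_assoc]
    -- With c = x + y + z, the arguments become x + z = c - y and y + z = c - x; for fixed c the
    -- double sum then factors into two copies of `r c`.
    have h1 : ∀ x y, ∑' z, p x * q y *
        (massConv p m (x + z) * massConv q m (y + z) / r (x + (y + z))) =
        ∑' c, p x * q y * (massConv p m (c - y) * massConv q m (c - x) / r c) := fun x y => by
      rw [← (Equiv.addLeft (x + y)).tsum_eq
        (fun c => p x * q y * (massConv p m (c - y) * massConv q m (c - x) / r c))]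
      refine tsum_congr fun z => ?_
      simp only [Equiv.coe_addLeft]
      rw [show x + y + z - y = x + z by abel, show x + y + z - x = y + z by abel, add_assoc x y z]
    calc _ = ∑' x, ∑' y, ∑' c, p x * q y *
          (massConv p m (c - y) * massConv q m (c - x) / r c) := by simp only [h1]
      _ = ∑' c, ∑' x, ∑' y, p x * q y *
          (massConv p m (c - y) * massConv q m (c - x) / r c) := by
        rw [tsum_congr fun x => ENNReal.tsum_comm, ENNReal.tsum_comm]
      _ = ∑' c, r c * (r c * (r c)⁻¹) := by
        refine tsum_congr fun c => ?_
        have hA : ∑' x, p x * massConv q m (c - x) = r c := rfl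
        have hB : ∑' y, q y * massConv p m (c - y) = r c := by rw [hr2]; rfl
        have e : ∀ x y, p x * q y * (massConv p m (c - y) * massConv q m (c - x) / r c) =
            p x * massConv q m (c - x) * (q y * massConv p m (c - y) * (r c)⁻¹) := fun x y => by
          rw [div_eq_mul_inv]; ring
        simp only [e, ENNReal.tsum_mul_left, ENNReal.tsum_mul_right, hA, hB]
      _ ≤ ∑' c, r c := ENNReal.tsum_le_tsum fun c => 
        mul_le_of_le_one_right' (ENNReal.mul_inv_le_one _)
      _ = 1 := hr

/-- The entropic Ruzsa triangle inequality. -/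
theorem massEntropy_massConv_massNeg_add_le {p q m : G → ℝ≥0∞} (hp : ∑' x, p x = 1)
    (hq : ∑' x, q x = 1) (hm : ∑' x, m x = 1) :
    massEntropy (massConv p (massNeg q)) + massEntropy m ≤
      massEntropy (massConv p m) + massEntropy (massConv q m) := by
  have hr := tsum_massConv hp (tsum_massNeg hq)
  have hsum : ∀ f : G → ℝ≥0∞, ∑' c, massConv p (massNeg q) c * f c =
      ∑' x, ∑' y, p x * q y * f (x - y) := fun f => by
    rw [tsum_massConv_mul]
    refine tsum_congr fun x => ?_
    simp only [mul_assoc, ENNReal.tsum_mul_left]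
    rw [tsum_massNeg_mul q (fun y => f (x + y))]
    simp only [sub_eq_add_neg]
  refine entropy_submodularity hp hq hm hr (fun x y _ => x - y) (fun x y z hx hy _ => ?_) ?_ ?_
  · rw [sub_eq_add_neg]
    exact massConv_ne_zero hx (by simpa [massNeg] using hy)
  · rw [massEntropy, hsum]
    simp only [ENNReal.tsum_mul_left, ENNReal.tsum_mul_right, hm, mul_one]
  · set r := massConv p (massNeg q)
    -- Substituting v = y + z leaves dependence on x and y only through x - y, whose law is `r`;
    -- this law cancels the denominator.
    have h1 : ∀ x y, ∑' z, massConv p m (x + z) * massConv q m (y + z) =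
        ∑' v, massConv p m (x - y + v) * massConv q m v := fun x y => by
      rw [← (Equiv.addLeft y).tsum_eq (fun v => massConv p m (x - y + v) * massConv q m v)]
      refine tsum_congr fun z => ?_
      simp only [Equiv.coe_addLeft]
      rw [show x - y + (y + z) = x + z by abel]
    simp only [div_eq_mul_inv, ENNReal.tsum_mul_left, ENNReal.tsum_mul_right, h1]
    rw [← hsum (fun c => (∑' v, massConv p m (c + v) * massConv q m v) * (r c)⁻¹)]
    calc _ ≤ ∑' c, ∑' v, massConv p m (c + v) * massConv q m v :=
          ENNReal.tsum_le_tsum fun c => by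
            rw [mul_left_comm]
            exact mul_le_of_le_one_right' (ENNReal.mul_inv_le_one _)
      _ = 1 := by
        rw [ENNReal.tsum_comm]
        have : ∀ v, ∑' c, massConv p m (c + v) = 1 := fun v => by
          rw [← tsum_massConv hp hm, ← (Equiv.addRight v).tsum_eq (massConv p m)]; rfl
        simp only [ENNReal.tsum_mul_right, this, one_mul, tsum_massConv hq hm]

end Convolution

theorem exists_ne_of_massEntropy_ne_zero {α : Type*} {p : α → ℝ≥0∞} (hp : ∑' x, p x = 1)
    (h : massEntropy p ≠ 0) : ∃ x y, x ≠ y ∧ p x ≠ 0 ∧ p y ≠ 0 := by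
  obtain ⟨x, hx⟩ : ∃ x, p x * surprisal (p x) ≠ 0 := by
    by_contra! hc
    exact h (by simp [massEntropy, hc])
  refine ⟨x, ?_⟩
  by_contra! hc
  have hx0 := left_ne_zero_of_mul hx
  have : p x = 1 := by
    rw [← hp, tsum_eq_single x fun y hy => ?_]
    exact hc y hy.symm hx0
  exact right_ne_zero_of_mul hx (by rw [this, surprisal_one])

/-! ### From random variables to mass functions. -/

section Measure

variable {Ω G : Type*} [MeasurableSpace Ω] {μ : Measure Ω}

/-- Addition on G need not be measurable, so measurability is asked only of the pieces of E on the
fibres of X. All but countably many fibres lie in one null set. -/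
theorem measure_eq_tsum_inter_of_isDiscreteRV {X : Ω → G} (hX : IsDiscreteRV X μ) (E : Set Ω)
    (hE : ∀ x, NullMeasurableSet (X ⁻¹' {x} ∩ E) μ) : μ E = ∑' x, μ (X ⁻¹' {x} ∩ E) := by
  obtain ⟨S, hS, hXS⟩ := hX
  have h1 : μ E = μ (⋃ x ∈ S, X ⁻¹' {x} ∩ E) := by
    refine measure_congr ?_
    filter_upwards [hXS] with ω hω
    refine propext ⟨fun h => ?_, fun h => ?_⟩
    · exact Set.mem_biUnion hω ⟨rfl, h⟩
    · obtain ⟨x, -, hx⟩ := Set.mem_iUnion₂.1 h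
      exact hx.2
  rw [h1, measure_biUnion₀ hS ?_ fun x _ => hE x]
  · refine tsum_subtype_eq_of_support_subset (f := fun x => μ (X ⁻¹' {x} ∩ E)) fun x hx => ?_
    by_contra hxS
    refine hx (measure_mono_null Set.inter_subset_left (measure_mono_null ?_ (ae_iff.1 hXS)))
    rintro ω rfl
    exact hxS
  · refine fun x _ y _ hxy => Disjoint.aedisjoint (Set.disjoint_left.2 ?_)
    rintro ω ⟨rfl, -⟩ ⟨h, -⟩
    exact hxy h

theorem shannonEntropy_eq_massEntropy [IsFiniteMeasure μ] (Z : Ω → G) :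
    shannonEntropy Z μ = massEntropy fun z => μ (Z ⁻¹' {z}) :=
  tsum_congr fun _ => ofReal_negMulLog _ (measure_ne_top μ _)

variable [AddCommGroup G] [MeasurableSpace G] [MeasurableSingletonClass G] {X Y : Ω → G}

theorem measure_add_eq_massConv (hXY : IndepFun X Y μ) (hX : AEMeasurable X μ)
    (hY : AEMeasurable Y μ) (hd : IsDiscreteRV X μ) (c : G) :
    μ ((fun ω => X ω + Y ω) ⁻¹' {c}) =
      massConv (fun x => μ (X ⁻¹' {x})) (fun y => μ (Y ⁻¹' {y})) c := by
  have h : ∀ x, X ⁻¹' {x} ∩ (fun ω => X ω + Y ω) ⁻¹' {c} = X ⁻¹' {x} ∩ Y ⁻¹' {c - x} := by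
    intro x
    ext ω
    simp only [Set.mem_inter_iff, Set.mem_preimage, Set.mem_singleton_iff, and_congr_right_iff]
    rintro rfl
    rw [eq_sub_iff_add_eq']
  rw [measure_eq_tsum_inter_of_isDiscreteRV hd]
  · refine tsum_congr fun x => ?_
    rw [h, hXY.measure_inter_preimage_eq_mul _ _ (measurableSet_singleton _)
      (measurableSet_singleton _)]
  · intro x
    rw [h]
    exact (hX.nullMeasurableSet_preimage (measurableSet_singleton _)).inter
      (hY.nullMeasurableSet_preimage (measurableSet_singleton _))

theorem measure_sub_eq_massConv (hXY : IndepFun X Y μ) (hX : AEMeasurable X μ)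
    (hY : AEMeasurable Y μ) (hd : IsDiscreteRV X μ) (c : G) :
    μ ((fun ω => X ω - Y ω) ⁻¹' {c}) =
      massConv (fun x => μ (X ⁻¹' {x})) (massNeg fun y => μ (Y ⁻¹' {y})) c := by
  have h : ∀ x, X ⁻¹' {x} ∩ (fun ω => X ω - Y ω) ⁻¹' {c} = X ⁻¹' {x} ∩ Y ⁻¹' {-(c - x)} := by
    intro x
    ext ω
    simp only [Set.mem_inter_iff, Set.mem_preimage, Set.mem_singleton_iff, and_congr_right_iff]
    rintro rfl
    rw [neg_sub, eq_sub_iff_add_eq, sub_eq_iff_eq_add, add_comm, eq_comm]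
  rw [measure_eq_tsum_inter_of_isDiscreteRV hd]
  · refine tsum_congr fun x => ?_
    rw [h, hXY.measure_inter_preimage_eq_mul _ _ (measurableSet_singleton _)
      (measurableSet_singleton _)]
    rfl
  · intro x
    rw [h]
    exact (hX.nullMeasurableSet_preimage (measurableSet_singleton _)).inter
      (hY.nullMeasurableSet_preimage (measurableSet_singleton _))

end Measure

/-! ### The main theorem. -/

theorem mainTheorem3 {Ω G : Type*} [MeasurableSpace Ω]
    [AddCommGroup G] [MeasurableSpace G] [MeasurableSingletonClass G]
    (μ : Measure Ω) [IsProbabilityMeasure μ] (X Y : Ω → G)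
    (hXY_indep : IndepFun X Y μ) (hXY_ident : IdentDistrib X Y μ μ)
    (hX_discrete : IsDiscreteRV X μ) (hX_finite : shannonEntropy X μ ≠ ∞) :
    shannonEntropy (fun ω => X ω + Y ω) μ ≠ ∞ ∧
    shannonEntropy (fun ω => X ω - Y ω) μ ≠ ∞ ∧
    3 / 4 < ratio (shannonEntropy (fun ω => X ω + Y ω) μ).toReal
      (shannonEntropy (fun ω => X ω - Y ω) μ).toReal ∧
    ratio (shannonEntropy (fun ω => X ω + Y ω) μ).toReal
      (shannonEntropy (fun ω => X ω - Y ω) μ).toReal < 4 / 3 := by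
  have hXm := hXY_ident.aemeasurable_fst
  have hYm := hXY_ident.aemeasurable_snd
  have hYX : (fun y => μ (Y ⁻¹' {y})) = fun x => μ (X ⁻¹' {x}) :=
    funext fun x => (hXY_ident.measure_mem_eq (measurableSet_singleton x)).symm
  have hp : ∑' x, μ (X ⁻¹' {x}) = 1 := by
    have := measure_eq_tsum_inter_of_isDiscreteRV hX_discrete Set.univ fun x => by
      simpa using hXm.nullMeasurableSet_preimage (measurableSet_singleton x)
    simpa using this.symm
  simp only [shannonEntropy_eq_massEntropy,
    measure_add_eq_massConv hXY_indep hXm hYm hX_discrete,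
    measure_sub_eq_massConv hXY_indep hXm hYm hX_discrete, hYX] at hX_finite ⊢
  generalize (fun x => μ (X ⁻¹' {x})) = p at hp hX_finite ⊢
  have hn := tsum_massNeg hp
  have en := massEntropy_massNeg p
  have hfn : massEntropy (massNeg p) ≠ ∞ := en ▸ hX_finite
  have h2 : massEntropy p + massEntropy p ≠ ∞ := ENNReal.add_ne_top.2 ⟨hX_finite, hX_finite⟩
  have hA := massEntropy_massConv_le hp hp
  have hB := massEntropy_massConv_le hp hn
  rw [en] at hB
  have hA' := ne_top_of_le_ne_top h2 hA
  have hB' := ne_top_of_le_ne_top h2 hB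
  have hAB : massEntropy (massConv p p) + massEntropy p ≤
      massEntropy (massConv p (massNeg p)) + massEntropy (massConv p (massNeg p)) := by
    have h := massEntropy_massConv_massConv_add_le hp hp hn
    rw [en, ← massConv_assoc] at h
    exact (add_le_add_left (massEntropy_le_massConv (tsum_massConv hp hp) hn) _).trans h
  have hBA := massEntropy_massConv_massNeg_add_le hp hp hp
  refine ⟨hA', hB', ?_⟩
  -- In the degenerate case A = B = 0 and the convention 0/0 = 1 applies.
  by_cases h0 : massEntropy p = 0
  · rw [h0, add_zero, nonpos_iff_eq_zero] at hA hB
    norm_num [ratio, hA, hB]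
  obtain ⟨x, y, hxy, hx, hy⟩ := exists_ne_of_massEntropy_ne_zero hp h0
  have hAlt := massEntropy_massConv_lt hp hp hX_finite hX_finite hxy (add_comm x y) hx hy hy hx
  have hBlt := massEntropy_massConv_lt hp hn hX_finite hfn hxy
    ((add_neg_cancel x).trans (add_neg_cancel y).symm) hx (by simpa [massNeg] using hx) hy
    (by simpa [massNeg] using hy)
  rw [en] at hBlt
  lift massEntropy (massConv p p) to NNReal using hA' with A
  lift massEntropy (massConv p (massNeg p)) to NNReal using hB' with B
  lift massEntropy p to NNReal using hX_finite with h
  norm_cast at hAB hBA hAlt hBlt h0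
  have h0' : (0 : ℝ) < h := by exact_mod_cast pos_iff_ne_zero.2 h0
  have hAB' : (A : ℝ) + h ≤ B + B := by exact_mod_cast hAB
  have hBA' : (B : ℝ) + h ≤ A + A := by exact_mod_cast hBA
  have hAlt' : (A : ℝ) < h + h := by exact_mod_cast hAlt
  have hBlt' : (B : ℝ) < h + h := by exact_mod_cast hBlt
  -- Eliminating A from `hAB'` and `hBA'` gives B ≥ h.
  have hBpos : (0 : ℝ) < B := by linarith
  rw [ENNReal.coe_toReal, ENNReal.coe_toReal, ratio, if_neg fun h => hBpos.ne' h.2,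
    lt_div_iff₀ hBpos, div_lt_iff₀ hBpos]
  constructor <;> linarith
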